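/- For positive integers $k,n,\ell$ let $r_k(n;\ell)$ be the least $N$ such that for every coloring of the $k$-element subsets of an $N$-element set with $\ell$ colors there is a monochromatic set of size $n$, i.e. an $n$-element subset all of whose $k$-element subsets have the same color. Define the tower function by $t_1(x)=x$ and $t_{i+1}(x)=2^{t_i(x)}$. There is an absolute constant $c>0$ such that for all integers $k\ge 1$, $n\ge 3k$ and $\ell\ge 4$, $$r_k(n;\ell)>t_k(cn).$$ This is tight up to the constant factor: for every $\ell\ge 4$ there is a constant $C>0$, depending only on $\ell$ (and not on $k$ or $n$), such that for all integers $k\ge 1$ and $n\ge 3k$, $$r_k(n;\ell)<t_k(Cn).$$ -/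

import Mathlib

/-- The tower function: `t₁(x) = x` and `t_{i+1}(x) = 2 ^ t_i(x)`.
The index starts at `1`; the value at index `0` is a convention that is not used. -/
noncomputable def tower : ℕ → ℝ → ℝ
  | 0, x => x
  | 1, x => x
  | k + 2, x => (2 : ℝ) ^ tower (k + 1) x

/-- `A` is monochromatic for the colouring `χ` of the `k`-subsets of `{0, …, N-1}`:
all `k`-subsets of `A` have the same colour. -/
def IsMonochromatic {N ℓ : ℕ} (k : ℕ) (χ : Finset (Fin N) → Fin ℓ) (A : Finset (Fin N)) : Prop :=
  ∃ i : Fin ℓ, ∀ e : Finset (Fin N), e ⊆ A → e.card = k → χ e = i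

/-- The partition relation `N → (n)_ℓ^k`: every `ℓ`-colouring of the `k`-subsets of an `N`-element
set has a monochromatic set of size `n`. For `ℓ ≥ 1` a colouring of the `k`-subsets is the
same as a function on all finite subsets of which only the values at `k`-subsets matter. -/
def Arrows (N n k ℓ : ℕ) : Prop :=
  ∀ χ : Finset (Fin N) → Fin ℓ, ∃ A : Finset (Fin N), A.card = n ∧ IsMonochromatic k χ A

/-- The Ramsey number `r_k(n; ℓ)`: the least `N` with `N → (n)_ℓ^k`. -/
noncomputable def ramseyNumber (k n ℓ : ℕ) : ℕ :=
  sInf {N : ℕ | Arrows N n k ℓ}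

/-!
The lower bound is a chain of stepping-up constructions in which each passage from uniformity `k` to
`k + 1` gains one exponential and, for `k ≥ 4`, costs only two elements in the size of the
monochromatic set; over all uniformities this costs about `2 * k ≤ 2 * n / 3` elements, so that a
fixed proportion of `n` is left for the start of the chain.

In a stepping-up construction the vertices are the numbers below `2 ^ N`, and a `(k + 1)`-set is
coloured according to the sequence of its `k` digits: the positions of the highest binary digits in
which consecutive elements differ (`splitLevel`). A set with monotone digits gets the old colour of
its set of digits. Hence a monochromatic set cannot have `n` consecutive monotone digits if the old
colouring has no monochromatic `n`-set (`exists_windows_of_arrows`), and the rule for non-monotone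
digits has to exclude all other patterns. With four colours one can record the initial direction of
the digits and the parity of the position of their first turn. A monochromatic set with `n + 2`
elements has `n + 1` digits. If their first turn is neither at the very beginning nor at the very
end, two consecutive windows of `k ≥ 4` digits contain it as their first turn, at positions of
different parity. If it is at the end, the digits before it are a monotone run of length `n`. If it
is at the beginning, then either the last `n` digits are monotone, or some later window is not
monotone and starts in the opposite direction (`not_arrows_succ_of_not_arrows`). The chain starts from Erdős' random
two-colouring of pairs (`not_arrows_two`). The step to triples doubles the number of colours, and
the step from triples to quadruples uses the directions alone and doubles the size.

The upper bound iterates the Erdős–Rado recursion (`Arrows.succ`), which bounds the next Ramsey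
number by `ℓ ^ (2 * M ^ k)`, where `M` bounds the previous one. The polynomial losses are absorbed by
adding a constant to the argument of the tower at each step (`mul_tower_le`); the total of these
constants is at most `2 * k ≤ n`.
-/

/-! ### Highest differing binary digits -/

/-- The least `d` such that `a` and `b` agree after deleting their `d` lowest binary digits. For
`a ≠ b` this is one more than the index of the highest binary digit in which they differ. -/
noncomputable def splitLevel (a b : ℕ) : ℕ := sInf {d : ℕ | a / 2 ^ d = b / 2 ^ d}

lemma splitLevel_le_iff {a b d : ℕ} : splitLevel a b ≤ d ↔ a / 2 ^ d = b / 2 ^ d := by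
  constructor
  · intro h
    have hne : {d : ℕ | a / 2 ^ d = b / 2 ^ d}.Nonempty := by
      refine ⟨max a b, ?_⟩
      have h1 : a / 2 ^ max a b = 0 :=
        Nat.div_eq_of_lt (lt_of_le_of_lt (le_max_left a b) Nat.lt_two_pow_self)
      have h2 : b / 2 ^ max a b = 0 :=
        Nat.div_eq_of_lt (lt_of_le_of_lt (le_max_right a b) Nat.lt_two_pow_self)
      exact h1.trans h2.symm
    have hmem : a / 2 ^ splitLevel a b = b / 2 ^ splitLevel a b := Nat.sInf_mem hne
    obtain ⟨r, rfl⟩ := Nat.exists_eq_add_of_le h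
    rw [pow_add, ← Nat.div_div_eq_div_mul, ← Nat.div_div_eq_div_mul, hmem]
  · exact fun h => Nat.sInf_le h

lemma splitLevel_pos {a b : ℕ} (h : a ≠ b) : 0 < splitLevel a b := by
  by_contra h0
  have := splitLevel_le_iff.1 (not_lt.1 h0)
  simp at this
  exact h this

lemma splitLevel_le {a b N : ℕ} (ha : a < 2 ^ N) (hb : b < 2 ^ N) : splitLevel a b ≤ N := by
  rw [splitLevel_le_iff, Nat.div_eq_of_lt ha, Nat.div_eq_of_lt hb]

lemma splitLevel_eq_max {a b c : ℕ} (hab : a ≤ b) (hbc : b ≤ c) :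
    splitLevel a c = max (splitLevel a b) (splitLevel b c) := by
  refine eq_of_forall_ge_iff fun d => ?_
  rw [max_le_iff, splitLevel_le_iff, splitLevel_le_iff, splitLevel_le_iff]
  have h1 : a / 2 ^ d ≤ b / 2 ^ d := Nat.div_le_div_right hab
  have h2 : b / 2 ^ d ≤ c / 2 ^ d := Nat.div_le_div_right hbc
  omega

lemma splitLevel_ne {a b c : ℕ} (hab : a < b) (hbc : b < c) :
    splitLevel a b ≠ splitLevel b c := by
  intro h
  obtain ⟨d, hd⟩ : ∃ d, splitLevel a b = d + 1 :=
    ⟨splitLevel a b - 1, by have := splitLevel_pos hab.ne; omega⟩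
  have h1 : ¬ splitLevel a b ≤ d := by omega
  have h2 : ¬ splitLevel b c ≤ d := by omega
  have h3 := splitLevel_le_iff.1 hd.le
  have h4 := splitLevel_le_iff.1 (h ▸ hd).le
  rw [splitLevel_le_iff] at h1 h2
  rw [pow_succ, ← Nat.div_div_eq_div_mul, ← Nat.div_div_eq_div_mul] at h3 h4
  have h5 : a / 2 ^ d ≤ b / 2 ^ d := Nat.div_le_div_right hab.le
  have h6 : b / 2 ^ d ≤ c / 2 ^ d := Nat.div_le_div_right hbc.le
  omega

/-- The `i`-th smallest element of `e`, counting from `0`; the value is `0` for `i ≥ e.card`. -/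
noncomputable def nthElt (e : Finset ℕ) (i : ℕ) : ℕ :=
  if h : i < e.card then e.orderEmbOfFin rfl ⟨i, h⟩ else 0

lemma nthElt_mem {e : Finset ℕ} {i : ℕ} (h : i < e.card) : nthElt e i ∈ e := by
  rw [nthElt, dif_pos h]
  exact e.orderEmbOfFin_mem rfl _

lemma nthElt_lt {e : Finset ℕ} {i j : ℕ} (hij : i < j) (h : j < e.card) :
    nthElt e i < nthElt e j := by
  rw [nthElt, nthElt, dif_pos h, dif_pos (hij.trans h)]
  exact (e.orderEmbOfFin rfl).strictMono hij

lemma exists_nthElt_eq {e : Finset ℕ} {x : ℕ} (hx : x ∈ e) : ∃ i < e.card, nthElt e i = x := by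
  have : x ∈ Set.range (e.orderEmbOfFin rfl) := by
    rw [Finset.range_orderEmbOfFin]; exact hx
  obtain ⟨i, rfl⟩ := this
  exact ⟨i, i.2, by rw [nthElt, dif_pos i.2]⟩

lemma card_image_range {b : ℕ → ℕ} {m : ℕ} (hb : ∀ i j, i < j → j < m → b i < b j) :
    ((Finset.range m).image b).card = m := by
  rw [Finset.card_image_of_injOn, Finset.card_range]
  intro i hi j hj hij
  simp only [Finset.coe_range, Set.mem_Iio] at hi hj
  rcases lt_trichotomy i j with h | h | h
  · exact absurd hij (hb i j h hj).ne
  · exact h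
  · exact absurd hij (hb j i h hi).ne'

lemma nthElt_image_range {b : ℕ → ℕ} {m : ℕ} (hb : ∀ i j, i < j → j < m → b i < b j)
    {i : ℕ} (hi : i < m) : nthElt ((Finset.range m).image b) i = b i := by
  have hc := card_image_range hb
  rw [nthElt, dif_pos (by omega)]
  have key := Finset.orderEmbOfFin_unique (s := (Finset.range m).image b) rfl
    (f := fun i : Fin ((Finset.range m).image b).card => b i)
    (fun x => Finset.mem_image_of_mem b (Finset.mem_range.2 (by have := x.2; omega)))
    (fun x y hxy => hb x y hxy (by have := y.2; omega))
  exact (congrFun key ⟨i, by omega⟩).symm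

/-- Along an increasing run of digits, two elements first differ at the last digit of the run between
them. -/
lemma splitLevel_eq_last {a : ℕ → ℕ} {i j : ℕ} (hij : i ≤ j)
    (ha : ∀ x y, i ≤ x → x ≤ y → y ≤ j + 1 → a x ≤ a y)
    (hd : ∀ x, i ≤ x → x < j →
      splitLevel (a x) (a (x + 1)) ≤ splitLevel (a (x + 1)) (a (x + 2))) :
    splitLevel (a i) (a (j + 1)) = splitLevel (a j) (a (j + 1)) := by
  induction j, hij using Nat.le_induction with
  | base => rfl
  | succ j hij ih =>
    rw [splitLevel_eq_max (ha i (j + 1) le_rfl (by omega) (by omega))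
      (ha (j + 1) (j + 2) (by omega) (by omega) le_rfl),
      ih (fun x y h1 h2 h3 => ha x y h1 h2 (by omega)) (fun x h1 h2 => hd x h1 (by omega))]
    exact max_eq_right (hd j hij (by omega))

/-- Along a decreasing run of digits, two elements first differ at the first digit of the run between
them. -/
lemma splitLevel_eq_first {a : ℕ → ℕ} {i j : ℕ} (hij : i ≤ j)
    (ha : ∀ x y, i ≤ x → x ≤ y → y ≤ j + 1 → a x ≤ a y)
    (hd : ∀ x, i ≤ x → x < j →
      splitLevel (a (x + 1)) (a (x + 2)) ≤ splitLevel (a x) (a (x + 1))) :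
    splitLevel (a i) (a (j + 1)) = splitLevel (a i) (a (i + 1)) := by
  have key : splitLevel (a i) (a (j + 1)) = splitLevel (a i) (a (i + 1)) ∧
      splitLevel (a j) (a (j + 1)) ≤ splitLevel (a i) (a (i + 1)) := by
    induction j, hij using Nat.le_induction with
    | base => exact ⟨rfl, le_rfl⟩
    | succ j hij ih =>
      obtain ⟨h1, h2⟩ := ih (fun x y h1 h2 h3 => ha x y h1 h2 (by omega))
        (fun x h1 h2 => hd x h1 (by omega))
      have h3 := (hd j hij (by omega)).trans h2
      refine ⟨?_, h3⟩
      rw [splitLevel_eq_max (ha i (j + 1) le_rfl (by omega) (by omega))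
        (ha (j + 1) (j + 2) (by omega) (by omega) le_rfl), h1]
      exact max_eq_left h3
  exact key.1

/-! ### The transfer behind stepping up -/

/-- A strictly monotone finite sequence: the values `d 0, …, d (k - 1)` increase or decrease. -/
def MonoSeq (k : ℕ) (d : ℕ → ℕ) : Prop :=
  (∀ i, i + 1 < k → d i < d (i + 1)) ∨ (∀ i, i + 1 < k → d (i + 1) < d i)

/-- A colouring of the finite sets of elements of `Fin N`, read as a colouring of finite sets of
natural numbers. Elements outside `{0, …, N - 1}` are ignored. -/
def extendColouring {N ℓ : ℕ} (χ : Finset (Fin N) → Fin ℓ) (e : Finset ℕ) : Fin ℓ :=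
  χ (Finset.univ.filter fun x : Fin N => (x : ℕ) ∈ e)

/-- If all `k`-subsets of an `n`-subset `A` of `{0, …, N - 1}` have the same colour, then `χ` has a
monochromatic set of size `n`. -/
lemma exists_isMonochromatic_of_nat {N ℓ k n : ℕ} {χ : Finset (Fin N) → Fin ℓ} (A : Finset ℕ)
    (hA : ∀ x ∈ A, x < N) (hn : A.card = n) (c : Fin ℓ)
    (hc : ∀ e ⊆ A, e.card = k → extendColouring χ e = c) :
    ∃ B : Finset (Fin N), B.card = n ∧ IsMonochromatic k χ B := by
  refine ⟨Finset.univ.filter fun x : Fin N => (x : ℕ) ∈ A, ?_, c, fun e he hk => ?_⟩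
  · rw [← hn, ← Finset.card_map Fin.valEmbedding]
    congr 1
    ext x
    simp only [Finset.mem_map, Finset.mem_filter, Finset.mem_univ, true_and,
      Fin.valEmbedding_apply]
    constructor
    · rintro ⟨y, hy, rfl⟩; exact hy
    · exact fun hx => ⟨⟨x, hA x hx⟩, hx, rfl⟩
  · have := hc (e.map Fin.valEmbedding) (fun x hx => by
      simp only [Finset.mem_map, Fin.valEmbedding_apply] at hx
      obtain ⟨y, hy, rfl⟩ := hx
      simpa using he hy) (by rw [Finset.card_map, hk])
    rw [← this, extendColouring]
    congr 1
    ext x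
    simp [Fin.val_inj]

/-- Every `k`-subset of the values of an injective run of `d` is the set of values of `d` along an
increasing sequence of `k` indices. -/
lemma exists_subseq_of_subset_image {d : ℕ → ℕ} {i n k : ℕ}
    (hinj : Set.InjOn d (Finset.Ico i (i + n))) {e : Finset ℕ}
    (he : e ⊆ (Finset.Ico i (i + n)).image d) (hk : e.card = k) :
    ∃ t : ℕ → ℕ, (∀ x y, x < y → y < k → t x < t y) ∧ (∀ x, x < k → i ≤ t x ∧ t x < i + n) ∧
      (Finset.range k).image (fun j => d (t j)) = e := by
  set T := (Finset.Ico i (i + n)).filter (fun x => d x ∈ e) with hT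
  have hTe : T.image d = e := by
    ext y
    constructor
    · intro hy
      obtain ⟨x, hx, rfl⟩ := Finset.mem_image.1 hy
      exact (Finset.mem_filter.1 hx).2
    · intro hy
      obtain ⟨x, hx, rfl⟩ := Finset.mem_image.1 (he hy)
      exact Finset.mem_image_of_mem d (Finset.mem_filter.2 ⟨hx, hy⟩)
  have hTk : T.card = k := by
    rw [← hk, ← hTe, Finset.card_image_of_injOn]
    exact hinj.mono (fun x hx => (Finset.mem_filter.1 hx).1)
  refine ⟨nthElt T, fun x y hxy hy => nthElt_lt hxy (by omega), fun x hx => ?_, ?_⟩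
  · have := (Finset.mem_filter.1 (nthElt_mem (e := T) (i := x) (by omega))).1
    exact Finset.mem_Ico.1 this
  · rw [← hTe]
    ext y
    simp only [Finset.mem_image, Finset.mem_range]
    constructor
    · rintro ⟨j, hj, rfl⟩
      exact ⟨_, nthElt_mem (by omega), rfl⟩
    · rintro ⟨x, hx, rfl⟩
      obtain ⟨j, hj, rfl⟩ := exists_nthElt_eq hx
      exact ⟨j, by omega, rfl⟩

lemma strictMono_of_steps {d : ℕ → ℕ} {i j : ℕ} (h : ∀ x, i ≤ x → x + 1 < j → d x < d (x + 1))
    {x y : ℕ} (hx : i ≤ x) (hxy : x < y) (hy : y < j) : d x < d y := by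
  induction y, hxy using Nat.le_induction with
  | base => exact h x hx hy
  | succ y hxy ih => exact (ih (by omega)).trans (h y (by omega) hy)

lemma strictAnti_of_steps {d : ℕ → ℕ} {i j : ℕ} (h : ∀ x, i ≤ x → x + 1 < j → d (x + 1) < d x)
    {x y : ℕ} (hx : i ≤ x) (hxy : x < y) (hy : y < j) : d y < d x := by
  induction y, hxy using Nat.le_induction with
  | base => exact h x hx hy
  | succ y hxy ih => exact (h y (by omega) hy).trans (ih (by omega))

/-- The common part of all stepping-up arguments. A `(k + 1)`-subset `v₀ < ⋯ < vₖ` of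
`{0, …, 2 ^ N - 1}` is coloured by a function `F` of the sequence of the highest binary digits in
which consecutive elements differ; on monotone sequences, `F` determines the `χ`-colour of the set
of these digits. If `χ` has no monochromatic `n`-set, then the digits `d` of a monochromatic
`m`-set have no monotone run of length `n`, whereas `F` is constant on the windows of length `k`
of `d`. -/
lemma exists_windows_of_arrows {N n k m ℓ ℓ' : ℕ} {χ : Finset (Fin N) → Fin ℓ}
    (hχ : ¬ ∃ A : Finset (Fin N), A.card = n ∧ IsMonochromatic k χ A)
    {F : (ℕ → ℕ) → Fin ℓ'} {g : Fin ℓ' → Fin ℓ} (hk : 1 ≤ k)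
    (hF : ∀ d d' : ℕ → ℕ, (∀ i < k, d i = d' i) → F d = F d')
    (hg : ∀ d, MonoSeq k d → g (F d) = extendColouring χ ((Finset.range k).image d))
    (h : Arrows (2 ^ N) m (k + 1) ℓ') :
    ∃ (d : ℕ → ℕ) (c : Fin ℓ'), (∀ i, i + k + 1 ≤ m → F (fun j => d (i + j)) = c) ∧
      ∀ i, i + n + 1 ≤ m →
        ∃ j, i ≤ j ∧ j + 1 < i + n ∧ ¬ (d j < d (j + 1) ↔ d i < d (i + 1)) := by
  let digits : Finset ℕ → ℕ → ℕ := fun e i => splitLevel (nthElt e i) (nthElt e (i + 1)) - 1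
  obtain ⟨A, hA, c, hc⟩ := h fun e => F (digits (e.map Fin.valEmbedding))
  let a : ℕ → ℕ := nthElt (A.map Fin.valEmbedding)
  have hcard : (A.map Fin.valEmbedding).card = m := by rw [Finset.card_map, hA]
  have ha : ∀ i j, i < j → j < m → a i < a j := fun i j hij hj => nthElt_lt hij (by omega)
  have ha' : ∀ i j, i ≤ j → j < m → a i ≤ a j := fun i j hij hj => by
    rcases hij.eq_or_lt with rfl | hlt
    · exact le_rfl
    · exact (ha i j hlt hj).le
  have haN : ∀ i, i < m → a i < 2 ^ N := fun i hi => by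
    have : a i ∈ A.map Fin.valEmbedding := nthElt_mem (by omega)
    obtain ⟨y, -, hy⟩ := Finset.mem_map.1 this
    rw [← hy]
    exact y.2
  -- every selection `s` of `k + 1` indices gives a `(k + 1)`-subset of `A`
  have hsel : ∀ s : ℕ → ℕ, (∀ x y, x < y → y < k + 1 → s x < s y) → s k < m →
      F (fun j => splitLevel (a (s j)) (a (s (j + 1))) - 1) = c := by
    intro s hs hsm
    have hsm' : ∀ j, j < k + 1 → s j < m := fun j hj => by
      rcases (Nat.lt_succ_iff.1 hj).eq_or_lt with rfl | hlt
      · exact hsm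
      · exact (hs j k hlt (by omega)).trans hsm
    have has : ∀ x y, x < y → y < k + 1 → a (s x) < a (s y) :=
      fun x y hxy hy => ha _ _ (hs x y hxy hy) (hsm' y hy)
    set e : Finset ℕ := (Finset.range (k + 1)).image (fun j => a (s j)) with he
    have heA : e ⊆ A.map Fin.valEmbedding := by
      intro x hx
      obtain ⟨j, hj, rfl⟩ := Finset.mem_image.1 hx
      exact nthElt_mem (by rw [hcard]; exact hsm' j (Finset.mem_range.1 hj))
    obtain ⟨e', he'A, he'⟩ := Finset.subset_map_iff.1 heA
    have hek : e'.card = k + 1 := by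
      rw [← Finset.card_map Fin.valEmbedding, ← he']
      exact card_image_range has
    rw [← hc e' he'A hek]
    simp only [← he']
    refine hF _ _ fun i hi => ?_
    have e1 : nthElt e i = a (s i) := nthElt_image_range has (by omega)
    have e2 : nthElt e (i + 1) = a (s (i + 1)) := nthElt_image_range has (by omega)
    simp only [digits, e1, e2]
  let d : ℕ → ℕ := fun i => splitLevel (a i) (a (i + 1)) - 1
  have hpos : ∀ i, i + 1 < m → 0 < splitLevel (a i) (a (i + 1)) := fun i hi =>
    splitLevel_pos (ha i (i + 1) (by omega) hi).ne
  have hdN : ∀ i, i + 1 < m → d i < N := fun i hi => by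
    have h1 := hpos i hi
    have h2 := splitLevel_le (haN i (by omega)) (haN (i + 1) hi)
    simp only [d]; omega
  have hdne : ∀ i, i + 2 < m → d i ≠ d (i + 1) := fun i hi => by
    have h1 := hpos i (by omega)
    have h2 := hpos (i + 1) (by omega)
    have h3 := splitLevel_ne (ha i (i + 1) (by omega) (by omega))
      (ha (i + 1) (i + 2) (by omega) (by omega))
    simp only [d]
    have e : i + 1 + 1 = i + 2 := rfl
    rw [e] at h2 ⊢
    omega
  refine ⟨d, c, fun i hi => ?_, fun i hi => ?_⟩
  · rw [← hsel (fun j => i + j) (fun x y hxy _ => by omega) (by omega)]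
    rfl
  · by_contra hcon
    push Not at hcon
    -- in a monotone run, each subsequence of digits comes from a subset of `A`
    have hrun : ((∀ x, i ≤ x → x + 1 < i + n → d x < d (x + 1)) ∨
        (∀ x, i ≤ x → x + 1 < i + n → d (x + 1) < d x)) := by
      by_cases hup : d i < d (i + 1)
      · exact Or.inl fun x h1 h2 => (hcon x h1 h2).2 hup
      · refine Or.inr fun x h1 h2 => ?_
        have h3 := hdne x (by omega)
        have h4 : ¬ d x < d (x + 1) := fun h => hup ((hcon x h1 h2).1 h)
        omega
    have hinj : Set.InjOn d (Finset.Ico i (i + n)) := by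
      intro x hx y hy hxy
      simp only [Finset.coe_Ico, Set.mem_Ico] at hx hy
      rcases hrun with hr | hr
      · rcases lt_trichotomy x y with hl | hl | hl
        · exact absurd hxy (strictMono_of_steps hr hx.1 hl hy.2).ne
        · exact hl
        · exact absurd hxy (strictMono_of_steps hr hy.1 hl hx.2).ne'
      · rcases lt_trichotomy x y with hl | hl | hl
        · exact absurd hxy (strictAnti_of_steps hr hx.1 hl hy.2).ne'
        · exact hl
        · exact absurd hxy (strictAnti_of_steps hr hy.1 hl hx.2).ne
    have hsub : ∀ t : ℕ → ℕ, (∀ x y, x < y → y < k → t x < t y) →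
        (∀ x, x < k → i ≤ t x ∧ t x < i + n) →
        F (fun j => d (t j)) = c ∧ MonoSeq k (fun j => d (t j)) := by
      intro t ht hti
      rcases hrun with hr | hr
      · refine ⟨?_, Or.inl fun j hj => strictMono_of_steps hr (hti j (by omega)).1
          (ht j (j + 1) (by omega) hj) (hti (j + 1) hj).2⟩
        let s : ℕ → ℕ := fun j => if j = 0 then t 0 else t (j - 1) + 1
        have hs1 : ∀ j, s (j + 1) = t j + 1 := fun j => by simp [s]
        have hsle : ∀ j, j < k → s j ≤ t j := fun j hj => by
          rcases j with _ | j
          · simp [s]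
          · rw [hs1]; exact ht j (j + 1) (by omega) hj
        have hsi : ∀ j, j < k → i ≤ s j := fun j hj => by
          rcases j with _ | j
          · simpa [s] using (hti 0 hj).1
          · rw [hs1]; have := (hti j (by omega)).1; omega
        have hs : ∀ x y, x < y → y < k + 1 → s x < s y := by
          intro x y hxy hy
          obtain ⟨y, rfl⟩ : ∃ z, y = z + 1 := ⟨y - 1, by omega⟩
          rw [hs1]
          have h1 := hsle x (by omega)
          rcases (Nat.lt_succ_iff.1 hxy).eq_or_lt with rfl | hlt
          · omega
          · have := ht x y hlt (by omega)
            omega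
        have hsk : s k < m := by
          obtain ⟨k, rfl⟩ : ∃ z, k = z + 1 := ⟨k - 1, by omega⟩
          rw [hs1]
          have := (hti k (by omega)).2
          omega
        rw [← hsel s hs hsk]
        refine hF _ _ fun j hj => ?_
        have htj := (hti j hj).2
        have hsj := hsi j hj
        rw [hs1]
        simp only [d]
        rw [splitLevel_eq_last (hsle j hj) (fun x y _ h2 h3 => ha' x y h2 (by omega))]
        intro x h1 h2
        have h3 := hr x (by omega) (by omega)
        simp only [d] at h3
        have e : x + 1 + 1 = x + 2 := rfl
        rw [e] at h3
        omega
      · refine ⟨?_, Or.inr fun j hj => strictAnti_of_steps hr (hti j (by omega)).1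
          (ht j (j + 1) (by omega) hj) (hti (j + 1) hj).2⟩
        let s : ℕ → ℕ := fun j => if j < k then t j else t (k - 1) + 1
        have hs0 : ∀ j, j < k → s j = t j := fun j hj => by simp [s, hj]
        have hsk : s k = t (k - 1) + 1 := by simp [s]
        have hs : ∀ x y, x < y → y < k + 1 → s x < s y := by
          intro x y hxy hy
          rw [hs0 x (by omega)]
          rcases (Nat.lt_succ_iff.1 hy).eq_or_lt with rfl | hlt
          · rw [hsk]
            rcases (Nat.le_sub_one_of_lt hxy).eq_or_lt with heq | hlt
            · rw [heq]; omega
            · have := ht x (y - 1) hlt (by omega)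
              omega
          · rw [hs0 y hlt]; exact ht x y hxy hlt
        have htk := (hti (k - 1) (by omega)).2
        rw [← hsel s hs (by omega)]
        refine hF _ _ fun j hj => ?_
        have hlt := hs j (j + 1) (by omega) (by omega)
        have hsm : s (j + 1) ≤ i + n := by
          rcases (Nat.succ_le_of_lt hj).eq_or_lt with heq | hlt
          · have : j + 1 = k := heq
            rw [this, hsk]; omega
          · rw [hs0 (j + 1) hlt]; exact (hti (j + 1) hlt).2.le
        rw [hs0 j hj] at hlt ⊢
        have hij := (hti j hj).1
        obtain ⟨z, hz⟩ : ∃ z, s (j + 1) = z + 1 := ⟨s (j + 1) - 1, by omega⟩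
        rw [hz] at hlt hsm ⊢
        simp only [d]
        rw [splitLevel_eq_first (Nat.lt_succ_iff.1 hlt)
          (fun x y _ h2 h3 => ha' x y h2 (by omega))]
        intro x h1 h2
        have h3 := hr x (by omega) (by omega)
        simp only [d] at h3
        have e : x + 1 + 1 = x + 2 := rfl
        rw [e] at h3
        omega
    refine hχ (exists_isMonochromatic_of_nat ((Finset.Ico i (i + n)).image d) ?_ ?_ (g c) ?_)
    · intro x hx
      obtain ⟨y, hy, rfl⟩ := Finset.mem_image.1 hx
      have := Finset.mem_Ico.1 hy
      exact hdN y (by omega)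
    · rw [Finset.card_image_of_injOn hinj]
      simp
    · intro e he hek
      obtain ⟨t, ht1, ht2, ht3⟩ := exists_subseq_of_subset_image hinj he hek
      obtain ⟨h1, h2⟩ := hsub t ht1 ht2
      rw [← h1, hg _ h2, ht3]

/-! ### Stepping-up colourings -/

lemma extendColouring_image_congr {N ℓ k : ℕ} (χ : Finset (Fin N) → Fin ℓ) {d d' : ℕ → ℕ}
    (h : ∀ i < k, d i = d' i) : extendColouring χ ((Finset.range k).image d) =
      extendColouring χ ((Finset.range k).image d') := by
  rw [Finset.image_congr fun i hi => h i (Finset.mem_range.1 (Finset.mem_coe.1 hi))]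

lemma not_arrows_three_of_not_arrows_two {N n : ℕ} (h : ¬ Arrows N n 2 2) :
    ¬ Arrows (2 ^ N) (n + 1) 3 4 := by
  intro harr
  rw [Arrows] at h
  push Not at h
  obtain ⟨χ, hχ⟩ := h
  -- the colour of a triple records whether its two digits increase, and their `χ`-colour
  let F : (ℕ → ℕ) → Fin 4 := fun d =>
    finProdFinEquiv (m := 2) (n := 2)
      (if d 0 < d 1 then 0 else 1, extendColouring χ ((Finset.range 2).image d))
  obtain ⟨d, c, hwin, hrun⟩ := exists_windows_of_arrows (k := 2) (F := F)
    (g := fun c => ((finProdFinEquiv (m := 2) (n := 2)).symm c).2)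
    (by rintro ⟨A, hA, hm⟩; exact hχ A hA hm) (by omega)
    (fun d d' hd => by
      simp only [F, extendColouring_image_congr χ hd, hd 0 (by omega), hd 1 (by omega)])
    (fun d _ => by simp only [F, Equiv.symm_apply_apply]) harr
  obtain ⟨j, -, hj, hne⟩ := hrun 0 (by omega)
  have h1 := (hwin j (by omega)).trans (hwin 0 (by omega)).symm
  simp only [F, EmbeddingLike.apply_eq_iff_eq, Prod.mk.injEq, add_zero, zero_add] at h1
  refine hne ?_
  have h2 := h1.1
  by_cases ha : d j < d (j + 1) <;> by_cases hb : d 0 < d 1 <;> simp [ha, hb] at h2 ⊢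

/-- The position of the first change of direction among `d 0, …, d (k - 1)`. -/
noncomputable def firstTurn (k : ℕ) (d : ℕ → ℕ) : ℕ :=
  sInf {i : ℕ | i + 2 < k ∧ ¬ (d i < d (i + 1) ↔ d (i + 1) < d (i + 2))}

lemma firstTurn_eq {k p : ℕ} {d : ℕ → ℕ} (hp : p + 2 < k)
    (hmin : ∀ i ≤ p, (d i < d (i + 1) ↔ d 0 < d 1))
    (hturn : ¬ (d p < d (p + 1) ↔ d (p + 1) < d (p + 2))) : firstTurn k d = p := by
  refine IsLeast.csInf_eq ⟨⟨hp, hturn⟩, fun i hi => ?_⟩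
  by_contra hlt
  exact hi.2 ((hmin i (by omega)).trans (hmin (i + 1) (by omega)).symm)

open Classical in
/-- The stepped-up colouring in terms of digit sequences. A monotone sequence gets the `χ`-colour
of its set of values; on the other sequences, the colour records the initial direction and the
parity of the position of the first change of direction. -/
noncomputable def stepColour {N : ℕ} (k : ℕ) (χ : Finset (Fin N) → Fin 4) (d : ℕ → ℕ) : Fin 4 :=
  if MonoSeq k d then extendColouring χ ((Finset.range k).image d)
  else finProdFinEquiv (m := 2) (n := 2)
    (if d 0 < d 1 then 0 else 1, ⟨firstTurn k d % 2, Nat.mod_lt _ two_pos⟩)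

lemma stepColour_congr {N k : ℕ} (hk : 2 ≤ k) (χ : Finset (Fin N) → Fin 4) {d d' : ℕ → ℕ}
    (h : ∀ i < k, d i = d' i) : stepColour k χ d = stepColour k χ d' := by
  have h1 : MonoSeq k d ↔ MonoSeq k d' := by
    unfold MonoSeq
    refine or_congr (forall_congr' fun i => ?_) (forall_congr' fun i => ?_) <;>
    · refine forall_congr' fun hi => ?_
      rw [h i (by omega), h (i + 1) hi]
  have h2 : firstTurn k d = firstTurn k d' := by
    unfold firstTurn
    congr 1
    ext i
    refine and_congr_right fun hi => ?_
    rw [h i (by omega), h (i + 1) (by omega), h (i + 2) hi]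
  by_cases hm : MonoSeq k d'
  · simp only [stepColour, if_pos hm, if_pos (h1.2 hm), extendColouring_image_congr χ h]
  · simp only [stepColour, if_neg hm, if_neg (mt h1.1 hm), h2, h 0 (by omega), h 1 (by omega)]

/-- A window of length `k` starting at `i`, all of whose steps up to the position `p` have the same
direction and which changes direction at `p`. -/
lemma stepColour_window {N k i p : ℕ} (χ : Finset (Fin N) → Fin 4) {d : ℕ → ℕ} (hip : i ≤ p)
    (hp : p + 2 < i + k) (hmin : ∀ x, i ≤ x → x ≤ p → (d x < d (x + 1) ↔ d i < d (i + 1)))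
    (hturn : ¬ (d p < d (p + 1) ↔ d (p + 1) < d (p + 2))) :
    stepColour k χ (fun j => d (i + j)) = finProdFinEquiv (m := 2) (n := 2)
      (if d i < d (i + 1) then 0 else 1, ⟨(p - i) % 2, Nat.mod_lt _ two_pos⟩) := by
  have e0 : i + (p - i) = p := by omega
  have e1 : i + (p - i + 1) = p + 1 := by omega
  have e2 : i + (p - i + 2) = p + 2 := by omega
  have hft : firstTurn k (fun j => d (i + j)) = p - i := by
    refine firstTurn_eq (by omega) (fun x hx => hmin (i + x) (by omega) (by omega)) ?_
    simpa only [e0, e1, e2] using hturn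
  have hnm : ¬ MonoSeq k (fun j => d (i + j)) := by
    rintro (hm | hm)
    · have h1 := hm (p - i) (by omega)
      have h2 := hm (p - i + 1) (by omega)
      simp only [e0, e1, add_assoc, Nat.reduceAdd, e2] at h1 h2
      exact hturn (iff_of_true h1 h2)
    · have h1 := hm (p - i) (by omega)
      have h2 := hm (p - i + 1) (by omega)
      simp only [e0, e1, add_assoc, Nat.reduceAdd, e2] at h1 h2
      exact hturn (iff_of_false (by omega) (by omega))
  rw [stepColour, if_neg hnm]
  simp only [hft, add_zero]

/-- The colour of a non-monotone sequence determines its initial direction and the parity of its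
first turn. -/
lemma window_colour_eq {u v : Prop} [Decidable u] [Decidable v] {x y : ℕ}
    (h : finProdFinEquiv (m := 2) (n := 2)
        (if u then 0 else 1, ⟨x % 2, Nat.mod_lt _ two_pos⟩) =
      finProdFinEquiv (m := 2) (n := 2)
        (if v then 0 else 1, ⟨y % 2, Nat.mod_lt _ two_pos⟩)) : (u ↔ v) ∧ x % 2 = y % 2 := by
  simp only [EmbeddingLike.apply_eq_iff_eq, Prod.mk.injEq, Fin.mk.injEq] at h
  refine ⟨?_, h.2⟩
  have h1 := h.1
  by_cases hu : u <;> by_cases hv : v <;> simp [hu, hv] at h1 ⊢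

/-- The stepping-up transfer for `stepColour`: a monochromatic `m`-set gives a sequence of digits
on which `stepColour` is constant on windows, and in which every `n` consecutive terms contain a
change of direction. The first such change is given. -/
lemma exists_stepColour_windows {N n k m : ℕ} {χ : Finset (Fin N) → Fin 4} (hk : 2 ≤ k)
    (hχ : ¬ ∃ A : Finset (Fin N), A.card = n ∧ IsMonochromatic k χ A)
    (h : Arrows (2 ^ N) m (k + 1) 4) :
    ∃ (d : ℕ → ℕ) (c : Fin 4),
      (∀ i, i + k + 1 ≤ m → stepColour k χ (fun j => d (i + j)) = c) ∧
      ∀ i, i + n + 1 ≤ m → ∃ p, i ≤ p ∧ p + 2 < i + n ∧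
        (∀ x, i ≤ x → x ≤ p → (d x < d (x + 1) ↔ d i < d (i + 1))) ∧
        ¬ (d p < d (p + 1) ↔ d (p + 1) < d (p + 2)) := by
  classical
  obtain ⟨d, c, hwin, hrun⟩ := exists_windows_of_arrows (F := stepColour k χ) (g := id) hχ
    (by omega) (fun d d' hd => stepColour_congr hk χ hd)
    (fun d hd => by simp [stepColour, hd]) h
  refine ⟨d, c, hwin, fun i hi => ?_⟩
  have hex := hrun i hi
  obtain ⟨hs1, hs2, hs3⟩ := Nat.find_spec hex
  have hmin : ∀ x, i ≤ x → x < Nat.find hex → (d x < d (x + 1) ↔ d i < d (i + 1)) := by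
    intro x h1 h2
    by_contra h3
    exact Nat.find_min hex h2 ⟨h1, by omega, h3⟩
  set j := Nat.find hex
  have hij : i ≠ j := fun h => hs3 (by rw [h])
  refine ⟨j - 1, by omega, by omega, fun x h1 h2 => hmin x h1 (by omega), fun h => hs3 ?_⟩
  have e1 : j - 1 + 1 = j := by omega
  have e2 : j - 1 + 2 = j + 1 := by omega
  rw [e1, e2] at h
  rw [← h]
  have := hmin (j - 1) (by omega) (by omega)
  rwa [e1] at this

lemma not_arrows_four_of_not_arrows_three {N n : ℕ} (h : ¬ Arrows N n 3 4) :
    ¬ Arrows (2 ^ N) (2 * n) 4 4 := by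
  intro harr
  rw [Arrows] at h
  push Not at h
  obtain ⟨χ, hχ⟩ := h
  obtain ⟨d, c, hwin, hrun⟩ := exists_stepColour_windows (k := 3) (by omega)
    (by rintro ⟨A, hA, hm⟩; exact hχ A hA hm) harr
  have hn : 1 ≤ n := by
    by_contra hn
    obtain rfl : n = 0 := by omega
    exact hχ ∅ rfl ⟨0, fun e he hk => by rw [Finset.subset_empty.1 he] at hk; simp at hk⟩
  obtain ⟨p, -, hp, hmin, hturn⟩ := hrun 0 (by omega)
  obtain ⟨p', hpp', hp', hmin', hturn'⟩ := hrun (p + 1) (by omega)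
  -- the two windows around the consecutive turns `p` and `p'` start in opposite directions
  have h1 := stepColour_window (k := 3) χ (le_refl p) (by omega)
    (fun x h1 h2 => by rw [le_antisymm h2 h1]) hturn
  have h2 := stepColour_window (k := 3) χ (le_refl p') (by omega)
    (fun x h1 h2 => by rw [le_antisymm h2 h1]) hturn'
  rw [hwin p (by omega)] at h1
  rw [hwin p' (by omega)] at h2
  have h3 := (window_colour_eq (h1.symm.trans h2)).1
  exact hturn (h3.trans (hmin' p' hpp' le_rfl))

/-- The improved stepping-up lemma: from uniformity `4` on, four colours suffice to gain an
exponential at the cost of only two additional elements. -/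
lemma not_arrows_succ_of_not_arrows {N n k : ℕ} (hk : 4 ≤ k) (hkn : k ≤ n)
    (h : ¬ Arrows N n k 4) : ¬ Arrows (2 ^ N) (n + 2) (k + 1) 4 := by
  intro harr
  rw [Arrows] at h
  push Not at h
  obtain ⟨χ, hχ⟩ := h
  obtain ⟨d, c, hwin, hrun⟩ := exists_stepColour_windows (k := k) (by omega)
    (by rintro ⟨A, hA, hm⟩; exact hχ A hA hm) harr
  obtain ⟨p, -, hp, hmin, hturn⟩ := hrun 0 (by omega)
  rcases Nat.eq_zero_or_pos p with rfl | hp0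
  · -- a turn at the very beginning is followed by a turn of the opposite type
    obtain ⟨p', hpp', hp', hmin', hturn'⟩ := hrun 1 (by omega)
    have h1 := stepColour_window (k := k) χ (le_refl 0) (by omega)
      (fun x h1 h2 => by rw [le_antisymm h2 h1]) hturn
    obtain ⟨i, hi1, hi2, hi3, hi4⟩ : ∃ i, 1 ≤ i ∧ i ≤ p' ∧ i + k + 1 ≤ n + 2 ∧ p' + 2 < i + k :=
      ⟨min p' (n + 1 - k), by omega, by omega, by omega, by omega⟩
    have h2 := stepColour_window (k := k) χ hi2 hi4
      (fun x h1 h2 => (hmin' x (by omega) h2).trans (hmin' i hi1 hi2).symm) hturn'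
    rw [hwin 0 (by omega)] at h1
    rw [hwin i hi3] at h2
    have h3 := (window_colour_eq (h1.symm.trans h2)).1
    exact hturn (h3.trans (hmin' i hi1 hi2))
  · -- otherwise two consecutive windows see the same first turn at positions of different parity
    obtain ⟨i, hi1, hi2, hi3⟩ : ∃ i, i + 1 ≤ p ∧ i + 1 + k + 1 ≤ n + 2 ∧ p + 2 < i + k :=
      ⟨min (p - 1) (n - k), by omega, by omega, by omega⟩
    have hm : ∀ i', i' ≤ p → ∀ x, i' ≤ x → x ≤ p → (d x < d (x + 1) ↔ d i' < d (i' + 1)) :=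
      fun i' hi' x _ h2 => (hmin x (by omega) h2).trans (hmin i' (by omega) hi').symm
    have h1 := stepColour_window (k := k) χ (i := i) (by omega) hi3 (hm i (by omega)) hturn
    have h2 := stepColour_window (k := k) χ hi1 (by omega) (hm (i + 1) hi1) hturn
    rw [hwin i (by omega)] at h1
    rw [hwin (i + 1) hi2] at h2
    have h3 := (window_colour_eq (h1.symm.trans h2)).2
    omega

/-! ### Random colourings -/

lemma card_colourings_const_on {α β : Type*} [Fintype α] [DecidableEq α] [Fintype β]
    [DecidableEq β] (T : Finset α) (c : β) :
    (Finset.univ.filter fun χ : α → β => ∀ e ∈ T, χ e = c).card * Fintype.card β ^ T.card =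
      Fintype.card β ^ Fintype.card α := by
  have h : (Finset.univ.filter fun χ : α → β => ∀ e ∈ T, χ e = c) =
      Fintype.piFinset fun e => if e ∈ T then {c} else Finset.univ := by
    ext χ
    simp only [Finset.mem_filter, Finset.mem_univ, true_and, Fintype.mem_piFinset]
    refine forall_congr' fun e => ?_
    by_cases he : e ∈ T <;> simp [he]
  have h2 : ∏ e : α, (if e ∈ T then Fintype.card β else 1) = Fintype.card β ^ T.card := by
    rw [Finset.prod_ite_mem, Finset.univ_inter, Finset.prod_const]
  rw [h, Fintype.card_piFinset, ← h2, ← Finset.prod_mul_distrib, ← Finset.card_univ (α := α),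
    ← Finset.prod_const]
  refine Finset.prod_congr rfl fun e _ => ?_
  by_cases he : e ∈ T <;> simp [he]

/-- Erdős' counting bound: a random colouring has no monochromatic `n`-set. -/
lemma not_arrows_of_choose_lt {N n k ℓ : ℕ} (hℓ : 0 < ℓ)
    (h : ℓ * N.choose n < ℓ ^ n.choose k) : ¬ Arrows N n k ℓ := by
  intro harr
  let bad : Finset (Fin N) × Fin ℓ → Finset (Finset (Fin N) → Fin ℓ) := fun p =>
    Finset.univ.filter fun χ => ∀ e ∈ p.1.powersetCard k, χ e = p.2
  let P : Finset (Finset (Fin N) × Fin ℓ) :=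
    ((Finset.univ : Finset (Fin N)).powersetCard n) ×ˢ Finset.univ
  have hcover : (Finset.univ : Finset (Finset (Fin N) → Fin ℓ)) ⊆ P.biUnion bad := by
    intro χ _
    obtain ⟨A, hA, c, hc⟩ := harr χ
    refine Finset.mem_biUnion.2 ⟨(A, c), ?_, ?_⟩
    · simp [P, hA]
    · simp only [bad, Finset.mem_filter, Finset.mem_univ, true_and]
      intro e he
      rw [Finset.mem_powersetCard] at he
      exact hc e he.1 he.2
  have hbad : ∀ p ∈ P, (bad p).card * ℓ ^ n.choose k = ℓ ^ Fintype.card (Finset (Fin N)) := by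
    intro p hp
    have hp1 : p.1.card = n := by
      have := (Finset.mem_product.1 hp).1
      exact (Finset.mem_powersetCard.1 this).2
    have := card_colourings_const_on (p.1.powersetCard k) p.2
    rw [Finset.card_powersetCard, hp1, Fintype.card_fin] at this
    exact this
  have h1 : ℓ ^ Fintype.card (Finset (Fin N)) ≤ ∑ p ∈ P, (bad p).card := by
    have := (Finset.card_le_card hcover).trans Finset.card_biUnion_le
    rwa [Finset.card_univ, Fintype.card_fun, Fintype.card_fin] at this
  have h2 : (∑ p ∈ P, (bad p).card) * ℓ ^ n.choose k =
      ℓ * N.choose n * ℓ ^ Fintype.card (Finset (Fin N)) := by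
    rw [Finset.sum_mul, Finset.sum_congr rfl hbad, Finset.sum_const, smul_eq_mul,
      Finset.card_product, Finset.card_powersetCard, Finset.card_univ, Finset.card_univ,
      Fintype.card_fin, Fintype.card_fin, mul_comm ℓ]
  have h3 := Nat.mul_le_mul_right (ℓ ^ n.choose k) h1
  rw [h2, mul_comm] at h3
  have hpos : 0 < ℓ ^ Fintype.card (Finset (Fin N)) := by positivity
  exact absurd (Nat.le_of_mul_le_mul_right h3 hpos) (not_le.2 h)

lemma not_arrows_two {q : ℕ} (hq : 1 ≤ q) : ¬ Arrows (2 ^ q) (4 * q) 2 2 := by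
  refine not_arrows_of_choose_lt two_pos ?_
  have h1 : (2 ^ q).choose (4 * q) ≤ 2 ^ (4 * q ^ 2) := by
    refine (Nat.choose_le_pow _ _).trans (le_of_eq ?_)
    rw [← pow_mul]
    congr 1
    ring
  have h2 : 4 * q ^ 2 + 1 < (4 * q).choose 2 := by
    have h3 : (4 * q).choose 2 = 2 * q * (4 * q - 1) := by
      rw [Nat.choose_two_right, show 4 * q * (4 * q - 1) = 2 * q * (4 * q - 1) * 2 by ring,
        Nat.mul_div_cancel _ two_pos]
    rw [h3]
    obtain ⟨r, rfl⟩ : ∃ r, q = r + 1 := ⟨q - 1, by omega⟩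
    have h4 : 4 * (r + 1) - 1 = 4 * r + 3 := by omega
    rw [h4]
    nlinarith
  calc 2 * (2 ^ q).choose (4 * q) ≤ 2 * 2 ^ (4 * q ^ 2) := Nat.mul_le_mul_left _ h1
    _ = 2 ^ (4 * q ^ 2 + 1) := by rw [pow_succ]; ring
    _ < 2 ^ (4 * q).choose 2 := Nat.pow_lt_pow_right (by omega) h2

/-! ### The Erdős–Rado recursion -/

lemma Arrows.mono_left {M N n k ℓ : ℕ} (h : Arrows M n k ℓ) (hMN : M ≤ N) : Arrows N n k ℓ := by
  intro χ
  obtain ⟨A, hA, c, hc⟩ := h fun e => χ (e.map (Fin.castLEEmb hMN))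
  refine ⟨A.map (Fin.castLEEmb hMN), by rw [Finset.card_map, hA], c, fun e he hk => ?_⟩
  obtain ⟨e', he', rfl⟩ := Finset.subset_map_iff.1 he
  exact hc e' he' (by rw [← hk, Finset.card_map])

lemma Arrows.mono_size {N n m k ℓ : ℕ} (h : Arrows N n k ℓ) (hmn : m ≤ n) : Arrows N m k ℓ := by
  intro χ
  obtain ⟨A, hA, c, hc⟩ := h χ
  obtain ⟨B, hBA, hB⟩ := Finset.exists_subset_card_eq (hA ▸ hmn)
  exact ⟨B, hB, c, fun e he hk => hc e (he.trans hBA) hk⟩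

lemma Arrows.mono_colours {N n k ℓ ℓ' : ℕ} (h : Arrows N n k ℓ') (hℓ : ℓ ≤ ℓ') (h0 : 0 < ℓ) :
    Arrows N n k ℓ := by
  intro χ
  obtain ⟨A, hA, c, hc⟩ := h fun e => Fin.castLE hℓ (χ e)
  refine ⟨A, hA, if hlt : (c : ℕ) < ℓ then ⟨c, hlt⟩ else ⟨0, h0⟩, fun e he hk => ?_⟩
  have h1 := hc e he hk
  have h2 : (χ e : ℕ) = c := by rw [← h1]; rfl
  have h3 : (c : ℕ) < ℓ := h2 ▸ (χ e).2
  rw [dif_pos h3]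
  exact Fin.ext h2

lemma arrows_one {n ℓ : ℕ} : Arrows (ℓ * n) n 1 ℓ := by
  intro χ
  rcases Nat.eq_zero_or_pos ℓ with rfl | hℓ
  · exact (χ ∅).elim0
  have : ∃ c ∈ (Finset.univ : Finset (Fin ℓ)),
      n ≤ ((Finset.univ : Finset (Fin (ℓ * n))).filter fun x => χ {x} = c).card := by
    apply Finset.exists_le_card_fiber_of_mul_le_card_of_maps_to
    · simp
    · exact ⟨⟨0, hℓ⟩, Finset.mem_univ _⟩
    · simp
  obtain ⟨c, -, hc⟩ := this
  obtain ⟨B, hB, hBn⟩ := Finset.exists_subset_card_eq hc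
  refine ⟨B, hBn, c, fun e he hk => ?_⟩
  obtain ⟨x, rfl⟩ := Finset.card_eq_one.1 hk
  exact (Finset.mem_filter.1 (hB (he (Finset.mem_singleton_self x)))).2

/-- `W` precedes `S`, and the colour of a `(k + 1)`-set `insert x e`, with `e` a `k`-subset of `W`
and `x ∈ W ∪ S` above `e`, does not depend on `x`. -/
def EndHomogeneous {N ℓ : ℕ} (k : ℕ) (χ : Finset (Fin N) → Fin ℓ) (W S : Finset (Fin N)) : Prop :=
  (∀ w ∈ W, ∀ x ∈ S, w < x) ∧
    ∀ e ⊆ W, e.card = k → ∃ c : Fin ℓ, ∀ x ∈ W ∪ S, (∀ y ∈ e, y < x) → χ (insert x e) = c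

/-- One step of the Erdős–Rado construction: the smallest element of `S` is moved to `W`, and `S`
is replaced by a largest class of remaining elements that are not distinguished by the new
`k`-subsets of `W`. -/
lemma EndHomogeneous.exists_step {N ℓ k t : ℕ} {χ : Finset (Fin N) → Fin ℓ}
    {W S : Finset (Fin N)} (h : EndHomogeneous (k + 1) χ W S) (ht : W.card = t)
    {q : ℕ} (hS : q * ℓ ^ t.choose k < S.card) :
    ∃ W' S' : Finset (Fin N), W'.card = t + 1 ∧ q ≤ S'.card ∧
      EndHomogeneous (k + 1) χ W' S' := by
  have hne : S.Nonempty := Finset.card_pos.1 (by omega)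
  set v := S.min' hne with hv
  have hvS : v ∈ S := S.min'_mem hne
  have hvW : v ∉ W := fun hw => lt_irrefl v (h.1 v hw v hvS)
  let Φ : Fin N → (W.powersetCard k → Fin ℓ) := fun x e => χ (insert x (insert v e.1))
  have hcardΦ : (Finset.univ : Finset (W.powersetCard k → Fin ℓ)).card = ℓ ^ t.choose k := by
    rw [Finset.card_univ, Fintype.card_fun, Fintype.card_fin, Fintype.card_coe,
      Finset.card_powersetCard, ht]
  have hpig : ∃ f ∈ (Finset.univ : Finset (W.powersetCard k → Fin ℓ)),
      q ≤ ((S.erase v).filter fun x => Φ x = f).card := by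
    apply Finset.exists_le_card_fiber_of_mul_le_card_of_maps_to
    · simp
    · exact ⟨Φ v, Finset.mem_univ _⟩
    · rw [hcardΦ, Finset.card_erase_of_mem hvS, mul_comm]
      omega
  obtain ⟨f, -, hf⟩ := hpig
  have hsub : ∀ x ∈ (S.erase v).filter fun x => Φ x = f, x ∈ S ∧ v < x ∧ Φ x = f := by
    intro x hx
    obtain ⟨h1, h2⟩ := Finset.mem_filter.1 hx
    obtain ⟨h3, h4⟩ := Finset.mem_erase.1 h1
    exact ⟨h4, lt_of_le_of_ne (S.min'_le x h4) (Ne.symm h3), h2⟩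
  refine ⟨insert v W, (S.erase v).filter fun x => Φ x = f, ?_, hf, ?_, ?_⟩
  · rw [Finset.card_insert_of_notMem hvW, ht]
  · intro w hw x hx
    obtain ⟨hxS, hvx, -⟩ := hsub x hx
    rcases Finset.mem_insert.1 hw with rfl | hw
    · exact hvx
    · exact h.1 w hw x hxS
  · intro e he hk
    by_cases hve : v ∈ e
    · have he' : e.erase v ∈ W.powersetCard k := by
        rw [Finset.mem_powersetCard, Finset.card_erase_of_mem hve, hk]
        exact ⟨fun y hy => by
          obtain ⟨h1, h2⟩ := Finset.mem_erase.1 hy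
          exact (Finset.mem_insert.1 (he h2)).resolve_left h1, rfl⟩
      refine ⟨f ⟨e.erase v, he'⟩, fun x hx hlt => ?_⟩
      have hvx := hlt v hve
      have hx' : x ∈ (S.erase v).filter fun x => Φ x = f := by
        rcases Finset.mem_union.1 hx with hx | hx
        · rcases Finset.mem_insert.1 hx with rfl | hx
          · exact absurd hvx (lt_irrefl _)
          · exact absurd (hvx.trans (h.1 x hx v hvS)) (lt_irrefl _)
        · exact hx
      have := congrFun (hsub x hx').2.2 ⟨e.erase v, he'⟩
      rw [← this]
      simp only [Φ, Finset.insert_erase hve]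
    · have heW : e ⊆ W := fun y hy =>
        (Finset.mem_insert.1 (he hy)).resolve_left (fun hyv => hve (hyv ▸ hy))
      obtain ⟨c, hc⟩ := h.2 e heW hk
      refine ⟨c, fun x hx hlt => hc x ?_ hlt⟩
      rcases Finset.mem_union.1 hx with hx | hx
      · rcases Finset.mem_insert.1 hx with rfl | hx
        · exact Finset.mem_union_right _ hvS
        · exact Finset.mem_union_left _ hx
      · exact Finset.mem_union_right _ (hsub x hx).1

lemma exists_endHomogeneous {N ℓ k M : ℕ} (hℓ : 0 < ℓ) (χ : Finset (Fin N) → Fin ℓ)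
    (hN : (2 * ℓ ^ M ^ k) ^ M ≤ N) {t : ℕ} (htM : t ≤ M) :
    ∃ W S : Finset (Fin N), W.card = t ∧ (2 * ℓ ^ M ^ k) ^ (M - t) ≤ S.card ∧
      EndHomogeneous (k + 1) χ W S := by
  induction t with
  | zero =>
    refine ⟨∅, Finset.univ, rfl, by simpa using hN, by simp, fun e he hk => ?_⟩
    rw [Finset.subset_empty.1 he] at hk
    simp at hk
  | succ t ih =>
    obtain ⟨W, S, hW, hS, h⟩ := ih (by omega)
    refine h.exists_step hW (lt_of_lt_of_le ?_ hS)
    have e : M - t = (M - (t + 1)) + 1 := by omega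
    rw [e, pow_succ]
    have h1 : ℓ ^ t.choose k ≤ ℓ ^ M ^ k := Nat.pow_le_pow_right hℓ
      ((Nat.choose_le_pow t k).trans (Nat.pow_le_pow_left (by omega) k))
    have h2 : 0 < ℓ ^ M ^ k := by positivity
    exact Nat.mul_lt_mul_of_pos_left (by omega) (by positivity)

/-- The Erdős–Rado recursion. An end-homogeneous sequence of length `M` turns the colouring of
`(k + 1)`-sets into a colouring of `k`-sets, and a monochromatic set of the latter can be extended
by one more element. -/
lemma Arrows.succ {M n k ℓ : ℕ} (hℓ : 2 ≤ ℓ) (hM : 1 ≤ M) (h : Arrows M n (k + 1) ℓ) :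
    Arrows (ℓ ^ (2 * M ^ (k + 1))) (n + 1) (k + 2) ℓ := by
  intro χ
  have hN : (2 * ℓ ^ M ^ k) ^ M ≤ ℓ ^ (2 * M ^ (k + 1)) := by
    calc (2 * ℓ ^ M ^ k) ^ M ≤ (ℓ ^ M ^ k * ℓ ^ M ^ k) ^ M := by
          refine Nat.pow_le_pow_left (Nat.mul_le_mul_right _ ?_) M
          calc 2 ≤ ℓ ^ 1 := by simpa using hℓ
            _ ≤ ℓ ^ M ^ k := Nat.pow_le_pow_right (by omega) (Nat.one_le_pow _ _ hM)
      _ = ℓ ^ (2 * M ^ (k + 1)) := by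
          rw [← pow_add, ← pow_mul]
          congr 1
          ring
  obtain ⟨W, S, hW, hS, hE⟩ := exists_endHomogeneous (by omega) χ hN (le_refl M)
  obtain ⟨x, hx⟩ : S.Nonempty := Finset.card_pos.1 (by simpa using hS)
  -- the element `x` above `W` is used to read off the colour induced on `(k + 1)`-subsets of `W`
  let emb : Fin M ↪ Fin (ℓ ^ (2 * M ^ (k + 1))) := (W.orderEmbOfFin hW).toEmbedding
  have hemb : ∀ A : Finset (Fin M), A.map emb ⊆ W := by
    intro A y hy
    obtain ⟨z, -, rfl⟩ := Finset.mem_map.1 hy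
    exact W.orderEmbOfFin_mem hW z
  obtain ⟨A, hA, c, hc⟩ := h fun e => χ (insert x (e.map emb))
  have hxA : x ∉ A.map emb := fun hxA => lt_irrefl x (hE.1 x (hemb A hxA) x hx)
  refine ⟨insert x (A.map emb), by rw [Finset.card_insert_of_notMem hxA, Finset.card_map, hA], c,
    fun e he hk => ?_⟩
  have hene : e.Nonempty := Finset.card_pos.1 (by omega)
  set y := e.max' hene with hy
  have hye : y ∈ e := e.max'_mem hene
  have hlt : ∀ z ∈ e.erase y, z < y := fun z hz => by
    obtain ⟨h1, h2⟩ := Finset.mem_erase.1 hz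
    exact lt_of_le_of_ne (e.le_max' z h2) h1
  have hyWS : ∀ z ∈ insert x (A.map emb), z ∈ W ∪ S := fun z hz => by
    rcases Finset.mem_insert.1 hz with rfl | hz
    · exact Finset.mem_union_right _ hx
    · exact Finset.mem_union_left _ (hemb A hz)
  have hsub : e.erase y ⊆ A.map emb := by
    intro z hz
    refine (Finset.mem_insert.1 (he (Finset.mem_of_mem_erase hz))).resolve_left ?_
    rintro rfl
    rcases Finset.mem_insert.1 (he hye) with h1 | h1
    · exact absurd (hlt z hz) (by rw [h1]; exact lt_irrefl _)
    · exact absurd (hlt z hz) (not_lt_of_gt (hE.1 y (hemb A h1) z hx))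
  obtain ⟨e', he', hee'⟩ := Finset.subset_map_iff.1 hsub
  have hcard : (e.erase y).card = k + 1 := by rw [Finset.card_erase_of_mem hye, hk]; rfl
  obtain ⟨c', hc'⟩ := hE.2 (e.erase y) (hsub.trans (hemb A)) hcard
  have h1 := hc' y (hyWS y (he hye)) hlt
  have h2 := hc' x (Finset.mem_union_right _ hx)
    (fun z hz => hE.1 z (hemb A (hsub hz)) x hx)
  rw [Finset.insert_erase hye] at h1
  rw [h1, ← h2, hee']
  exact hc e' he' (by rw [← hcard, hee', Finset.card_map])

/-! ### Bounds by towers -/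

lemma tower_add_two (k : ℕ) (x : ℝ) : tower (k + 2) x = (2 : ℝ) ^ tower (k + 1) x := rfl

lemma tower_mono (k : ℕ) {x y : ℝ} (h : x ≤ y) : tower (k + 1) x ≤ tower (k + 1) y := by
  induction k with
  | zero => exact h
  | succ k ih => exact Real.rpow_le_rpow_of_exponent_le one_le_two ih

lemma natCast_two_pow_eq {N : ℕ} {x : ℝ} (h : (N : ℝ) = x) : ((2 ^ N : ℕ) : ℝ) = (2 : ℝ) ^ x := by
  rw [← h, Real.rpow_natCast]
  push_cast
  rfl

lemma not_arrows_tower {q : ℕ} (hq : 1 ≤ q) (j : ℕ) :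
    ∃ N : ℕ, (N : ℝ) = tower (j + 4) q ∧ ¬ Arrows N (8 * q + 2 + 2 * j) (j + 4) 4 := by
  induction j with
  | zero =>
    refine ⟨2 ^ 2 ^ 2 ^ q, natCast_two_pow_eq (natCast_two_pow_eq (natCast_two_pow_eq rfl)), ?_⟩
    have := not_arrows_four_of_not_arrows_three
      (not_arrows_three_of_not_arrows_two (not_arrows_two hq))
    rwa [show 2 * (4 * q + 1) = 8 * q + 2 + 2 * 0 by ring] at this
  | succ j ih =>
    obtain ⟨N, hN, h⟩ := ih
    exact ⟨2 ^ N, natCast_two_pow_eq hN, not_arrows_succ_of_not_arrows (n := 8 * q + 2 + 2 * j)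
      (by omega) (by omega) h⟩

/-- For `k ≥ 2` an additive constant in the argument of the tower absorbs a factor `k + 2`. -/
lemma mul_tower_le (j : ℕ) {y : ℝ} (hy : 0 ≤ y) :
    1 ≤ tower (j + 2) y ∧ (j + 4) * tower (j + 2) y ≤ tower (j + 2) (y + 2) := by
  induction j with
  | zero =>
    constructor
    · exact Real.one_le_rpow one_le_two hy
    · change ((0 : ℕ) + 4 : ℝ) * (2 : ℝ) ^ y ≤ (2 : ℝ) ^ (y + 2)
      rw [Real.rpow_add two_pos, Real.rpow_two]
      push_cast
      linarith
  | succ j ih =>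
    obtain ⟨h1, h2⟩ := ih
    have ht : (2 : ℝ) ≤ tower (j + 3) y := by
      have := Real.rpow_le_rpow_of_exponent_le one_le_two h1
      rwa [Real.rpow_one] at this
    refine ⟨by linarith, ?_⟩
    have h3 : tower (j + 3) y ^ (j + 4) ≤ tower (j + 3) (y + 2) := by
      rw [tower_add_two (j + 1) y, tower_add_two (j + 1) (y + 2), ← Real.rpow_natCast, ← Real.rpow_mul two_pos.le]
      refine Real.rpow_le_rpow_of_exponent_le one_le_two ?_
      push_cast
      linarith
    have h4 : ((j + 1 : ℕ) + 4 : ℝ) ≤ tower (j + 3) y ^ (j + 3) := by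
      have h5 : ((j + 1 : ℕ) + 4 : ℝ) ≤ (2 : ℝ) ^ (j + 3) := by
        have : j + 5 ≤ 2 ^ (j + 3) := by
          have : j < 2 ^ j := Nat.lt_two_pow_self
          rw [pow_add]
          omega
        have : ((j + 5 : ℕ) : ℝ) ≤ ((2 ^ (j + 3) : ℕ) : ℝ) := by exact_mod_cast this
        push_cast at this ⊢
        linarith
      exact h5.trans (pow_le_pow_left₀ two_pos.le ht _)
    calc ((j + 1 : ℕ) + 4 : ℝ) * tower (j + 3) y
        ≤ tower (j + 3) y ^ (j + 3) * tower (j + 3) y :=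
          mul_le_mul_of_nonneg_right h4 (by linarith)
      _ = tower (j + 3) y ^ (j + 4) := (pow_succ _ _).symm
      _ ≤ _ := h3

/-- The iterated Erdős–Rado recursion. The bound on `2 * ℓ * M ^ k` rather than on `M` is what the
induction needs, as `M ^ k` appears in the exponent of the next bound. -/
lemma exists_arrows_le_tower {n ℓ : ℕ} (hn : 1 ≤ n) (hℓ : 2 ≤ ℓ) (j : ℕ) :
    ∃ M : ℕ, 1 ≤ M ∧ Arrows M n (j + 2) ℓ ∧
      (2 * ℓ * M ^ (j + 2) : ℝ) ≤ tower (j + 2) (6 * ℓ ^ 2 * n + 2 * j) := by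
  suffices h : ∃ M : ℕ, 1 ≤ M ∧ Arrows M (n + j + 1) (j + 2) ℓ ∧
      (2 * ℓ * M ^ (j + 2) : ℝ) ≤ tower (j + 2) (6 * ℓ ^ 2 * n + 2 * j) by
    obtain ⟨M, h1, h2, h3⟩ := h
    exact ⟨M, h1, h2.mono_size (by omega), h3⟩
  have hℓ2 : ∀ e : ℕ, ℓ ^ e ≤ 2 ^ (ℓ * e) := fun e => by
    rw [pow_mul]
    exact Nat.pow_le_pow_left Nat.lt_two_pow_self.le e
  induction j with
  | zero =>
    refine ⟨ℓ ^ (2 * (ℓ * n) ^ 1), Nat.one_le_pow _ _ (by omega),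
      arrows_one.succ hℓ (Nat.mul_pos (by omega) hn), ?_⟩
    have h1 : 2 * ℓ * (ℓ ^ (2 * (ℓ * n) ^ 1)) ^ 2 ≤ 2 ^ (6 * ℓ ^ 2 * n) := by
      calc 2 * ℓ * (ℓ ^ (2 * (ℓ * n) ^ 1)) ^ 2
          ≤ 2 ^ 1 * 2 ^ ℓ * 2 ^ (ℓ * (2 * (ℓ * n) * 2)) := by
            rw [← pow_mul, pow_one, pow_one]
            exact Nat.mul_le_mul (Nat.mul_le_mul_left 2 Nat.lt_two_pow_self.le) (hℓ2 _)
        _ = 2 ^ (1 + ℓ + 4 * (ℓ ^ 2 * n)) := by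
            rw [← pow_add, ← pow_add]
            congr 1
            ring
        _ ≤ 2 ^ (6 * ℓ ^ 2 * n) := by
            refine Nat.pow_le_pow_right two_pos ?_
            have h2 : ℓ ^ 2 * 1 ≤ ℓ ^ 2 * n := Nat.mul_le_mul_left _ hn
            nlinarith
    change (2 * ℓ * ((ℓ ^ (2 * (ℓ * n) ^ 1) : ℕ) : ℝ) ^ 2 : ℝ) ≤ (2 : ℝ) ^ _
    have h2 : ((2 * ℓ * (ℓ ^ (2 * (ℓ * n) ^ 1)) ^ 2 : ℕ) : ℝ) ≤ ((2 ^ (6 * ℓ ^ 2 * n) : ℕ) : ℝ) := by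
      exact_mod_cast h1
    rw [natCast_two_pow_eq rfl] at h2
    push_cast at h2 ⊢
    simpa [tower] using h2
  | succ j ih =>
    obtain ⟨M, hM, harr, hb⟩ := ih
    refine ⟨ℓ ^ (2 * M ^ (j + 2)), Nat.one_le_pow _ _ (by omega), harr.succ hℓ hM, ?_⟩
    set y : ℝ := 6 * ℓ ^ 2 * n + 2 * j with hy
    have hy0 : 0 ≤ y := by positivity
    have hyy : (6 * ℓ ^ 2 * n + 2 * ((j + 1 : ℕ) : ℝ) : ℝ) = y + 2 := by
      rw [hy]; push_cast; ring
    rw [hyy, tower_add_two]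
    have h1 : 2 * ℓ * (ℓ ^ (2 * M ^ (j + 2))) ^ (j + 3) ≤
        2 ^ (2 * ℓ * M ^ (j + 2) * (j + 4)) := by
      have hMp : 1 ≤ M ^ (j + 2) := Nat.one_le_pow _ _ hM
      calc 2 * ℓ * (ℓ ^ (2 * M ^ (j + 2))) ^ (j + 3)
          ≤ 2 ^ 1 * 2 ^ ℓ * 2 ^ (ℓ * (2 * M ^ (j + 2) * (j + 3))) := by
            rw [← pow_mul, pow_one]
            exact Nat.mul_le_mul (Nat.mul_le_mul_left 2 Nat.lt_two_pow_self.le) (hℓ2 _)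
        _ = 2 ^ (1 + ℓ + 2 * ℓ * M ^ (j + 2) * (j + 3)) := by
            rw [← pow_add, ← pow_add]
            congr 1
            ring
        _ ≤ 2 ^ (2 * ℓ * M ^ (j + 2) * (j + 4)) := by
            refine Nat.pow_le_pow_right two_pos ?_
            have : 1 + ℓ ≤ 2 * ℓ * M ^ (j + 2) := by nlinarith
            linarith
    have h2 : ((2 * ℓ * (ℓ ^ (2 * M ^ (j + 2))) ^ (j + 3) : ℕ) : ℝ) ≤
        ((2 ^ (2 * ℓ * M ^ (j + 2) * (j + 4)) : ℕ) : ℝ) := by exact_mod_cast h1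
    rw [natCast_two_pow_eq rfl] at h2
    have h3 : ((2 * ℓ * M ^ (j + 2) * (j + 4) : ℕ) : ℝ) ≤ tower (j + 2) (y + 2) := by
      push_cast
      calc (2 * ℓ * M ^ (j + 2) * (j + 4) : ℝ) ≤ tower (j + 2) y * (j + 4) :=
            mul_le_mul_of_nonneg_right hb (by positivity)
        _ ≤ _ := by rw [mul_comm]; exact (mul_tower_le j hy0).2
    refine le_trans ?_ (Real.rpow_le_rpow_of_exponent_le one_le_two h3)
    refine le_trans (le_of_eq ?_) h2
    push_cast
    rfl

lemma ramseyNumber_le {N n k ℓ : ℕ} (h : Arrows N n k ℓ) : ramseyNumber k n ℓ ≤ N :=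
  Nat.sInf_le h

/-- Ramsey's theorem: the set of which `ramseyNumber` is the infimum is not empty. -/
lemma exists_arrows {n k ℓ : ℕ} (hn : 1 ≤ n) (hk : 1 ≤ k) (hℓ : 2 ≤ ℓ) : ∃ N, Arrows N n k ℓ := by
  rcases k with _ | _ | j
  · omega
  · exact ⟨_, arrows_one⟩
  · obtain ⟨M, -, hM, -⟩ := exists_arrows_le_tower hn hℓ j
    exact ⟨M, hM⟩

lemma lt_ramseyNumber {N n k ℓ ℓ' : ℕ} (hn : 1 ≤ n) (hk : 1 ≤ k) (hℓ : 2 ≤ ℓ) (hℓ' : ℓ ≤ ℓ')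
    (h : ¬ Arrows N n k ℓ) : N < ramseyNumber k n ℓ' := by
  by_contra hle
  have hmem : Arrows (ramseyNumber k n ℓ') n k ℓ' :=
    Nat.sInf_mem (exists_arrows hn hk (hℓ.trans hℓ'))
  exact h ((hmem.mono_left (not_lt.1 hle)).mono_colours hℓ' (by omega))

lemma not_arrows_of_lt {N n k ℓ : ℕ} (hℓ : 0 < ℓ) (h : N < n) : ¬ Arrows N n k ℓ := by
  intro harr
  obtain ⟨A, hA, -⟩ := harr fun _ => ⟨0, hℓ⟩
  have := A.card_le_univ
  rw [Fintype.card_fin] at this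
  omega

theorem tower_lt_ramseyNumber {k n ℓ : ℕ} (hk : 1 ≤ k) (hn : 3 * k ≤ n) (hℓ : 4 ≤ ℓ) :
    tower k (1 / 32 * (n : ℝ)) < (ramseyNumber k n ℓ : ℝ) := by
  -- it suffices to find `N ≥ tower k (n / 32)` for which the partition relation fails
  have key : ∀ {N ℓ₀ : ℕ} {x : ℝ}, 2 ≤ ℓ₀ → ℓ₀ ≤ ℓ → (N : ℝ) = tower k x →
      1 / 32 * (n : ℝ) ≤ x → ¬ Arrows N n k ℓ₀ →
      tower k (1 / 32 * (n : ℝ)) < (ramseyNumber k n ℓ : ℝ) := by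
    intro N ℓ₀ x h2 hle hN hx harr
    obtain ⟨j, rfl⟩ : ∃ j, k = j + 1 := ⟨k - 1, by omega⟩
    refine lt_of_le_of_lt ((tower_mono j hx).trans_eq hN.symm) ?_
    exact_mod_cast lt_ramseyNumber (by omega) hk h2 hle harr
  have cast_bound : ∀ {q : ℕ}, n ≤ 32 * q → 1 / 32 * (n : ℝ) ≤ q := by
    intro q hq
    have : (n : ℝ) ≤ 32 * q := by exact_mod_cast hq
    linarith
  rcases k with _ | _ | _ | _ | j
  · omega
  · exact key (N := n - 1) (by omega) hℓ rfl (cast_bound (by omega))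
      (not_arrows_of_lt (by omega) (by omega))
  · refine key (N := 2 ^ (n / 4)) le_rfl (by omega) (natCast_two_pow_eq rfl)
      (cast_bound (by omega)) fun h => ?_
    exact not_arrows_two (q := n / 4) (by omega) (h.mono_size (by omega))
  · refine key (N := 2 ^ 2 ^ ((n - 1) / 4)) (by omega) hℓ
      (natCast_two_pow_eq (natCast_two_pow_eq rfl)) (cast_bound (by omega)) fun h => ?_
    exact not_arrows_three_of_not_arrows_two (not_arrows_two (q := (n - 1) / 4) (by omega))
      (h.mono_size (by omega))
  · -- the largest `q` with `8 * q + 2 + 2 * j ≤ n`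
    obtain ⟨N, hN, h⟩ := not_arrows_tower (q := (n - 2 - 2 * j) / 8) (by omega) j
    exact key (by omega) hℓ hN (cast_bound (by omega)) fun h' => h (h'.mono_size (by omega))

theorem ramseyNumber_lt_tower {k n ℓ : ℕ} (hk : 1 ≤ k) (hn : 3 * k ≤ n) (hℓ : 2 ≤ ℓ) :
    (ramseyNumber k n ℓ : ℝ) < tower k ((6 * ℓ ^ 2 + 2) * (n : ℝ)) := by
  have hℓR : (2 : ℝ) ≤ ℓ := by exact_mod_cast hℓ
  have hnR : (3 : ℝ) ≤ n := by exact_mod_cast (by omega : 3 ≤ n)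
  rcases k with _ | _ | j
  · omega
  · have h1 : (ramseyNumber 1 n ℓ : ℝ) ≤ ((ℓ * n : ℕ) : ℝ) := by
      exact_mod_cast ramseyNumber_le arrows_one
    refine lt_of_le_of_lt h1 ?_
    change ((ℓ * n : ℕ) : ℝ) < (6 * ℓ ^ 2 + 2) * (n : ℝ)
    push_cast
    exact mul_lt_mul_of_pos_right (by nlinarith) (by linarith)
  · obtain ⟨M, hM, harr, hb⟩ := exists_arrows_le_tower (n := n) (by omega) hℓ j
    have h1 : (ramseyNumber (j + 2) n ℓ : ℝ) ≤ M := by exact_mod_cast ramseyNumber_le harr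
    have hMR : (1 : ℝ) ≤ M := by exact_mod_cast hM
    have h2 : (M : ℝ) < 2 * ℓ * M ^ (j + 2) := by
      have : (M : ℝ) ≤ M ^ (j + 2) := le_self_pow₀ hMR (by omega)
      nlinarith
    refine h1.trans_lt (h2.trans_le (hb.trans (tower_mono (j + 1) ?_)))
    have : (j : ℝ) ≤ n := by exact_mod_cast (by omega : j ≤ n)
    linarith

theorem mainTheorem4 :
    (∃ c : ℝ, 0 < c ∧ ∀ k n ℓ : ℕ, 1 ≤ k → 3 * k ≤ n → 4 ≤ ℓ →
      tower k (c * (n : ℝ)) < (ramseyNumber k n ℓ : ℝ)) ∧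
    (∀ ℓ : ℕ, 4 ≤ ℓ → ∃ C : ℝ, 0 < C ∧ ∀ k n : ℕ, 1 ≤ k → 3 * k ≤ n →
      (ramseyNumber k n ℓ : ℝ) < tower k (C * (n : ℝ))) :=
  ⟨⟨1 / 32, by norm_num, fun _ _ _ hk hn hℓ => tower_lt_ramseyNumber hk hn hℓ⟩,
    fun ℓ hℓ => ⟨6 * ℓ ^ 2 + 2, by positivity, fun _ _ hk hn =>
      ramseyNumber_lt_tower hk hn (by omega)⟩⟩
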